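/- **Conventions.** $\Sigma$ is an alphabet; automata have finitely many states. Parity is min-parity: a bounded sequence of priorities is accepting iff its $\liminf$ is even. $L\subseteq\Sigma^\omega$ is $\omega$-regular if it is recognised by a (complete) deterministic parity automaton with priorities in $\{1,\dots,d\}$ for some $d$. **Layered automata.** A layered automaton consists of deterministic transition systems $\mathcal T_1,\dots,\mathcal T_d$ with disjoint finite state sets $Q_1,\dots,Q_d$ and partial transition functions $\delta_x$, and morphisms $\mu_x:\mathcal T_{x+1}\to\mathcal T_x$ (parent maps), such that $\mathcal T_1$ is complete, has an initial state $q_{\mathsf{init}}$, and all its states are reachable from $q_{\mathsf{init}}$. For $q\in Q_y$ and $x\le y$ let $\hat\mu_x(q)\in Q_x$ be its ancestor on layer $x$. A leaf is a state that is not in the image of any $\mu_x$. The semantics of a layered automaton is the alternating parity game automaton whose states are the leaves: from a leaf $q$ on letter $a$, with $x$ the largest layer such that $\delta_x(\hat\mu_x(q),a)$ is defined, there are transitions of priority $x$ to all leaves $q'$ below $\delta_x(\hat\mu_x(q),a)$; Eve chooses if $x$ is odd, Adam if $x$ is even, and $w\in\Sigma^\omega$ is accepted from $q$ if Eve has a winning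 strategy for the parity condition in the game over $w$ from $q$. Any leaf $q$ with $\hat\mu_1(q)=q_{\mathsf{init}}$ may serve as initial state; the automaton recognises $L$ if such a leaf exists and, whichever such leaf is chosen, the accepted language is $L$. A word $w\in\Sigma^\omega$ is strongly accepted (strongly rejected) by a state $p\in Q_x$ if $x$ is even (odd), the run over $w$ from $p$ in $\mathcal T_x$ is defined, and for no decomposition $w=uw'$ is there $p'\in Q_{x+1}$ such that $u$ leads from $p$ to $\mu_x(p')$ in $\mathcal T_x$ and the run over $w'$ from $p'$ in $\mathcal T_{x+1}$ is defined. The automaton is consistent if there are no states $p,p'$ with $\hat\mu_1(p)=\hat\mu_1(p')$ and no $w\in\Sigma^\omega$ such that $w$ is strongly accepted by $p$ and strongly rejected by $p'$. **The congruence.** For a tuple $\bar u=(u_1,\dots,u_x)\in(\Sigma^*)^x$, $x\ge 1$, and $v\in\Sigma^*$, write $\bar u\cdot v=(u_1,\dots,u_{x-1},u_xv)$ and $(\bar u,v)=(u_1,\dots,u_x,v)$. Given $L\subseteq\Sigma^\omega$, define $\bar u\approx\bot$, $\bar u\approx\bar v$ (for tuples of equal length) and "$\bar u$ is pointed" by induction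 on the length. - Length $1$: $(u)\not\approx\bot$ always; $(u)\approx(v)$ iff $\forall w\in\Sigma^\omega\,(uw\in L\Leftrightarrow vw\in L)$; every $(u)$ is pointed. - $(\bar u,u_{x+1})\approx\bot$ iff $\bar u\cdot u_{x+1}\approx\bot$, or for all $w\in\Sigma^+$ with $\bar u\cdot u_{x+1}w\approx\bar u$: $u_1\cdots u_x(u_{x+1}w)^\omega\in L\Leftrightarrow x$ is even. - $(\bar u,u_{x+1})\approx(\bar v,v_{x+1})$ iff $\bar u\cdot u_{x+1}\approx\bar v\cdot v_{x+1}$ and, for all $w\in\Sigma^*$, $(\bar u,u_{x+1}w)\not\approx\bot\Leftrightarrow(\bar v,v_{x+1}w)\not\approx\bot$. - $(\bar u,u_{x+1})$ is pointed iff $(\bar u,u_{x+1})\not\approx\bot$, $\bar u$ is pointed, and for all pointed $\bar v$ and all $v_{x+1}$ with $\bar v\cdot v_{x+1}\approx\bar u$: if $(\bar v,v_{x+1}u_{x+1})\not\approx\bot$ then $(\bar v,v_{x+1}u_{x+1})\approx(\bar u,u_{x+1})$. **The automaton $\mathcal A_\approx$.** The states on layer $x$ are the $\approx$-classes $[\bar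 u]$ of pointed tuples $\bar u\in(\Sigma^*)^x$; $\delta_x([\bar u],a)=[\bar u\cdot a]$ if $\bar u\cdot a\not\approx\bot$ and undefined otherwise; the parent of $[(\bar u,u_{x+1})]$ is $[\bar u\cdot u_{x+1}]$; the initial state is $[(\varepsilon)]$. **Theorem.** Let $L\subseteq\Sigma^\omega$ be $\omega$-regular. Then there is a largest $d$ such that some $\bar u\in(\Sigma^*)^d$ satisfies $\bar u\not\approx\bot$, and $\mathcal A_\approx$ is a layered automaton with layers $1,\dots,d$ that is consistent and recognises $L$. -/

import Mathlib

/-! Infinite words over an alphabet `A` are streams `Stream' A` and finite words are lists.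
Parity conditions are min-parity conditions. -/

namespace LayeredAut

open Filter

universe u v

/-! ### The parity condition, deterministic parity automata, omega-regular languages -/

/-- Min-parity condition: the least priority occurring infinitely often exists and is even, i.e.
the limit inferior of the (bounded) sequence of priorities is even. -/
def Parity (p : ℕ → ℕ) : Prop :=
  ∃ x, Even x ∧ (∀ᶠ i in atTop, x ≤ p i) ∧ ∃ᶠ i in atTop, p i = x

/-- A (complete) deterministic parity automaton with finitely many states and with priorities
in `{1, …, d}` on its transitions. -/
structure DPA (A : Type u) (d : ℕ) where
  State : Type
  finite : Finite State
  start : State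
  next : State → A → State
  prio : State → A → ℕ
  prio_mem : ∀ q a, prio q a ∈ Set.Icc 1 d

namespace DPA

variable {A : Type u} {d : ℕ}

/-- The state reached after the first `n` letters of `w`. -/
def stateAt (B : DPA A d) (w : Stream' A) : ℕ → B.State
  | 0 => B.start
  | n + 1 => B.next (B.stateAt w n) (w.get n)

/-- The language of a deterministic parity automaton. -/
def language (B : DPA A d) : Set (Stream' A) :=
  {w | Parity fun i => B.prio (B.stateAt w i) (w.get i)}

end DPA

/-- A language of infinite words is omega-regular if it is recognised by some deterministic
parity automaton. -/
def OmegaRegular {A : Type u} (L : Set (Stream' A)) : Prop :=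
  ∃ (d : ℕ) (B : DPA A d), B.language = L

/-! ### Alternating automata that are simple by priorities -/

/-- The transition structure of an alternating parity automaton in which the priority of a
transition decides who chooses it (Eve: odd, Adam: even). It is only used for complete automata in
which all `a`-transitions from a state have the same priority. -/
structure AltAutomaton (A : Type u) where
  State : Type v
  Step : State → A → ℕ → State → Prop

namespace AltAutomaton

variable {A : Type u} (B : AltAutomaton.{u, v} A)

/-- A (deterministic, history dependent) choice function for Eve: it reads the list of states
visited so far, the current one last, and returns the next state. As the input word is fixed and
the priority of a letter in a state is determined, this list determines the run so far. -/
abbrev Strategy : Type v := List B.State → B.State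

/-- The list of the states visited by `ρ` at times `0, …, i`. -/
def history (ρ : ℕ → B.State) (i : ℕ) : List B.State := (List.range (i + 1)).map ρ

/-- Whenever a run over a prefix of `w` from `q` has been built and Eve is to move (the priority
`x` of the next letter in the current state is odd), `σ` picks a transition of the automaton. -/
def Legal (w : Stream' A) (q : B.State) (σ : B.Strategy) : Prop :=
  ∀ (ρ : ℕ → B.State) (i : ℕ), ρ 0 = q →
    (∀ k < i, ∃ x, B.Step (ρ k) (w.get k) x (ρ (k + 1))) →
    ∀ x q', Odd x → B.Step (ρ i) (w.get i) x q' →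
      B.Step (ρ i) (w.get i) x (σ (B.history ρ i))

/-- `ρ`, with priorities `p`, is a run over `w` from `q`. -/
def IsRun (w : Stream' A) (q : B.State) (ρ : ℕ → B.State) (p : ℕ → ℕ) : Prop :=
  ρ 0 = q ∧ ∀ i, B.Step (ρ i) (w.get i) (p i) (ρ (i + 1))

/-- The language of a state `q`: the words `w` such that Eve has a winning strategy in the game
over `w` that starts in `q`. -/
def language (q : B.State) : Set (Stream' A) :=
  {w | ∃ σ : B.Strategy, B.Legal w q σ ∧
    ∀ ρ p, B.IsRun w q ρ p → (∀ i, Odd (p i) → ρ (i + 1) = σ (B.history ρ i)) → Parity p}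

end AltAutomaton

/-! ### Layered automata -/

/-- The data of a layered automaton. The pairwise disjoint state sets of the layers are given by
one type of states with a layer for each state; `next` collects the partial transition functions
of all the layers, `parent` the maps from layer `x + 1` to layer `x`. The value of `parent` on
states of layer `1` is irrelevant. -/
structure LayeredData (A : Type u) where
  State : Type v
  layer : State → ℕ
  next : State → A → Option State
  parent : State → State
  start : State

namespace LayeredData

variable {A : Type u} (M : LayeredData.{u, v} A)

/-- The run over a finite word, if it is defined. -/
def run : M.State → List A → Option M.State
  | q, [] => some q
  | q, a :: w => (M.next q a).bind fun q' => run q' w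

/-- `M` is a layered automaton with the layers `1, …, d`: finitely many states, each layer is a
deterministic transition system, the parent maps are morphisms from layer `x + 1` to layer `x`,
and layer `1` is complete and consists of states reachable from the initial state. -/
structure IsLayeredAutomaton (d : ℕ) : Prop where
  finite : Finite M.State
  layer_mem : ∀ q, M.layer q ∈ Set.Icc 1 d
  layer_next : ∀ q a q', M.next q a = some q' → M.layer q' = M.layer q
  layer_parent : ∀ q, 2 ≤ M.layer q → M.layer (M.parent q) + 1 = M.layer q
  morphism : ∀ q a q', 2 ≤ M.layer q → M.next q a = some q' →
    M.next (M.parent q) a = some (M.parent q')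
  complete : ∀ q a, M.layer q = 1 → (M.next q a).isSome
  layer_start : M.layer M.start = 1
  reachable : ∀ q, M.layer q = 1 → ∃ w, M.run M.start w = some q

/-- The ancestor on layer `x` of a state on a layer `≥ x`. -/
def ancestor (x : ℕ) (q : M.State) : M.State := M.parent^[M.layer q - x] q

/-- A leaf state is a state that is not the parent of any state. -/
def IsLeaf (q : M.State) : Prop := ¬ ∃ p, 2 ≤ M.layer p ∧ M.parent p = q

/-- `x` is the biggest layer on which the ancestor of `q` has an `a`-transition. -/
def IsPriority (q : M.State) (a : A) (x : ℕ) : Prop :=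
  IsGreatest {y | y ∈ Set.Icc 1 (M.layer q) ∧ (M.next (M.ancestor y q) a).isSome} x

/-- The semantics automaton. Its states are the leaf states; the `a`-transitions from `q` have the
biggest layer `x` on which the ancestor of `q` has an `a`-transition as priority, and lead to all
leaves below the target of that transition. -/
def sem : AltAutomaton.{u, v} A where
  State := {q : M.State // M.IsLeaf q}
  Step q a x q' := M.IsPriority q.1 a x ∧ x ≤ M.layer q'.1 ∧
    M.next (M.ancestor x q.1) a = some (M.ancestor x q'.1)

/-- The states that may serve as initial states of the semantics automaton: the leaves whose
ancestor on layer `1` is the initial state. -/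
def IsInitialLeaf (q : M.sem.State) : Prop := M.ancestor 1 q.1 = M.start

/-- `M` recognises `L`: the semantics automaton has an initial leaf, and its language is `L`
whichever initial leaf is used as its initial state. -/
def Recognises (L : Set (Stream' A)) : Prop :=
  (∃ q, M.IsInitialLeaf q) ∧ ∀ q, M.IsInitialLeaf q → M.sem.language q = L

/-- The run over the infinite word `w` from `q`, in the layer of `q`, is defined. -/
def Safe (q : M.State) (w : Stream' A) : Prop := ∀ n, (M.run q (w.take n)).isSome

/-- `w` is safe from `p`, and for no decomposition `w = u w'` and no state `p'` on the layer just
below that of `p` such that `u` leads from `p` to the parent of `p'`, the word `w'` is safe from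
`p'`. -/
def StronglySafe (p : M.State) (w : Stream' A) : Prop :=
  M.Safe p w ∧ ∀ n p', M.layer p' = M.layer p + 1 →
    M.run p (w.take n) = some (M.parent p') → ¬ M.Safe p' (w.drop n)

def StronglyAccepts (p : M.State) (w : Stream' A) : Prop := Even (M.layer p) ∧ M.StronglySafe p w

def StronglyRejects (p : M.State) (w : Stream' A) : Prop := Odd (M.layer p) ∧ M.StronglySafe p w

/-- No word is strongly accepted by one state and strongly rejected by another one with the same
ancestor on layer `1`. -/
def Consistent : Prop :=
  ¬ ∃ (p p' : M.State) (w : Stream' A), M.ancestor 1 p = M.ancestor 1 p' ∧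
    M.StronglyAccepts p w ∧ M.StronglyRejects p' w

end LayeredData

/-! ### The congruence on tuples of finite words -/

/-- Nonempty tuples of finite words: `single u` is `(u)`, and `snoc t z` is the tuple `t` extended
by the additional last component `z`. -/
inductive WordTuple (A : Type u) : Type u
  | single (u : List A) : WordTuple A
  | snoc (t : WordTuple A) (z : List A) : WordTuple A

namespace WordTuple

variable {A : Type u}

/-- The number of components. -/
def length : WordTuple A → ℕ
  | single _ => 1
  | snoc t _ => t.length + 1

/-- The concatenation of all the components. -/
def word : WordTuple A → List A
  | single u => u
  | snoc t z => t.word ++ z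

/-- Concatenation of a word to the last component. -/
def concat : WordTuple A → List A → WordTuple A
  | single u, v => single (u ++ v)
  | snoc t z, v => snoc t (z ++ v)

/-- Merging the last two components (the identity on tuples of length one). -/
def merge : WordTuple A → WordTuple A
  | single u => single u
  | snoc t z => t.concat z

theorem length_concat (t : WordTuple A) (v : List A) : (t.concat v).length = t.length := by
  cases t <;> rfl

theorem concat_concat (t : WordTuple A) (v w : List A) :
    (t.concat v).concat w = t.concat (v ++ w) := by
  cases t <;> simp [concat]

end WordTuple

open WordTuple

variable {A : Type u}

/-- The infinite word `u (z w) (z w) (z w) …` for nonempty `w`. -/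
def lasso (u z w : List A) (hw : w ≠ []) : Stream' A :=
  Stream'.appendStream' u (Stream'.cycle (z ++ w) (by simp [hw]))

theorem lasso_append (u z v w : List A) (hw : w ≠ []) :
    lasso u (z ++ v) w hw = lasso u z (v ++ w) (by simp [hw]) := by
  have key : ∀ (l l' : List A) (h : l ≠ []) (h' : l' ≠ []), l = l' →
      Stream'.cycle l h = Stream'.cycle l' h' := by
    rintro l _ h h' rfl
    rfl
  unfold lasso
  rw [key _ _ _ _ (List.append_assoc z v w)]

/-- The relations `t ≈ ⊥` (second argument `none`) and `t ≈ s` (second argument `some s`), by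
induction on the length of the tuples. For tuples of length one, `≈` is residual equivalence; a
tuple of length at least two is `≈`-equivalent to another one if their merges are equivalent and
they have the same safe language. The safe language is represented by the finite words in it,
which determine the infinite ones. -/
def Tc (L : Set (Stream' A)) : WordTuple A → Option (WordTuple A) → Prop
  | single _, none => False
  | snoc t z, none =>
      Tc L (t.concat z) none ∨
        ∀ (w : List A) (hw : w ≠ []), Tc L (t.concat (z ++ w)) (some t) →
          (lasso t.word z w hw ∈ L ↔ Even t.length)
  | single u, some (single v) =>
      ∀ w : Stream' A, Stream'.appendStream' u w ∈ L ↔ Stream'.appendStream' v w ∈ L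
  | snoc t z, some (snoc s y) =>
      Tc L (t.concat z) (some (s.concat y)) ∧
        ∀ w : List A, ¬ Tc L (snoc t (z ++ w)) none ↔ ¬ Tc L (snoc s (y ++ w)) none
  | single _, some (snoc _ _) => False
  | snoc _ _, some (single _) => False
termination_by t s =>
  match s with
  | none => 2 * t.length
  | some s => 2 * max t.length s.length + 1
decreasing_by
  all_goals simp only [length_concat, length]
  all_goals omega

/-- `t ≈ ⊥`. -/
def Bot (L : Set (Stream' A)) (t : WordTuple A) : Prop := Tc L t none

/-- `t ≈ s`. -/
def Equiv (L : Set (Stream' A)) (t s : WordTuple A) : Prop := Tc L t (some s)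

/-- Pointed tuples, by induction on the length. -/
def Pointed (L : Set (Stream' A)) : WordTuple A → Prop
  | single _ => True
  | snoc t z =>
      ¬ Bot L (snoc t z) ∧ Pointed L t ∧
        ∀ s : WordTuple A, s.length = t.length → Pointed L s →
          ∀ y : List A, Equiv L (s.concat y) t →
            ¬ Bot L (snoc s (y ++ z)) → Equiv L (snoc s (y ++ z)) (snoc t z)
termination_by t => t.length
decreasing_by
  all_goals simp only [length]
  all_goals omega

/-! ### Well-definedness of the operations on classes -/

section facts

variable (L : Set (Stream' A))

theorem bot_single (u : List A) : ¬ Bot L (single u) := by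
  simp [Bot, Tc]

theorem bot_snoc (t : WordTuple A) (z : List A) :
    Bot L (snoc t z) ↔ Bot L (t.concat z) ∨
      ∀ (w : List A) (hw : w ≠ []), Equiv L (t.concat (z ++ w)) t →
        (lasso t.word z w hw ∈ L ↔ Even t.length) := by
  simp only [Bot, Equiv]
  rw [Tc]

theorem equiv_single (u v : List A) :
    Equiv L (single u) (single v) ↔
      ∀ w : Stream' A, Stream'.appendStream' u w ∈ L ↔ Stream'.appendStream' v w ∈ L := by
  simp only [Equiv]
  rw [Tc]

theorem equiv_snoc (t s : WordTuple A) (z y : List A) :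
    Equiv L (snoc t z) (snoc s y) ↔ Equiv L (t.concat z) (s.concat y) ∧
      ∀ w : List A, ¬ Bot L (snoc t (z ++ w)) ↔ ¬ Bot L (snoc s (y ++ w)) := by
  simp only [Equiv, Bot]
  rw [Tc]

theorem not_equiv_single_snoc (u : List A) (s : WordTuple A) (y : List A) :
    ¬ Equiv L (single u) (snoc s y) := by
  simp [Equiv, Tc]

theorem not_equiv_snoc_single (u : List A) (s : WordTuple A) (y : List A) :
    ¬ Equiv L (snoc s y) (single u) := by
  simp [Equiv, Tc]

theorem pointed_single (u : List A) : Pointed L (single u) := by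
  simp [Pointed]

theorem pointed_snoc (t : WordTuple A) (z : List A) :
    Pointed L (snoc t z) ↔ ¬ Bot L (snoc t z) ∧ Pointed L t ∧
      ∀ s : WordTuple A, s.length = t.length → Pointed L s →
        ∀ y : List A, Equiv L (s.concat y) t →
          ¬ Bot L (snoc s (y ++ z)) → Equiv L (snoc s (y ++ z)) (snoc t z) := by
  rw [Pointed]

variable {L}

theorem equiv_refl : ∀ t : WordTuple A, Equiv L t t
  | single u => (equiv_single L u u).2 fun _ => Iff.rfl
  | snoc t z => (equiv_snoc L t t z z).2 ⟨equiv_refl (t.concat z), fun _ => Iff.rfl⟩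
termination_by t => t.length
decreasing_by simp [length_concat, length]

theorem equiv_symm : ∀ {t s : WordTuple A}, Equiv L t s → Equiv L s t
  | single u, single v, h => by
      rw [equiv_single] at h ⊢
      exact fun w => (h w).symm
  | single u, snoc s y, h => (not_equiv_single_snoc L u s y h).elim
  | snoc s y, single u, h => (not_equiv_snoc_single L u s y h).elim
  | snoc t z, snoc s y, h => by
      rw [equiv_snoc] at h ⊢
      exact ⟨equiv_symm h.1, fun w => (h.2 w).symm⟩
termination_by t => t.length
decreasing_by simp [length_concat, length]

theorem equiv_trans : ∀ {t s r : WordTuple A}, Equiv L t s → Equiv L s r → Equiv L t r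
  | single u, single v, single x, h, k => by
      rw [equiv_single] at h k ⊢
      exact fun w => (h w).trans (k w)
  | single u, snoc s y, _, h, _ => (not_equiv_single_snoc L u s y h).elim
  | snoc s y, single u, _, h, _ => (not_equiv_snoc_single L u s y h).elim
  | _, single u, snoc s y, _, k => (not_equiv_single_snoc L u s y k).elim
  | _, snoc s y, single u, _, k => (not_equiv_snoc_single L u s y k).elim
  | snoc t z, snoc s y, snoc r x, h, k => by
      rw [equiv_snoc] at h k ⊢
      exact ⟨equiv_trans h.1 k.1, fun w => (h.2 w).trans (k.2 w)⟩
termination_by t => t.length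
decreasing_by simp [length_concat, length]

theorem length_eq_of_equiv : ∀ {t s : WordTuple A}, Equiv L t s → t.length = s.length
  | single _, single _, _ => rfl
  | single u, snoc s y, h => (not_equiv_single_snoc L u s y h).elim
  | snoc s y, single u, h => (not_equiv_snoc_single L u s y h).elim
  | snoc t z, snoc s y, h => by
      have := length_eq_of_equiv ((equiv_snoc L t s z y).1 h).1
      simpa [length, length_concat] using this
termination_by t => t.length
decreasing_by simp [length_concat, length]

theorem bot_congr {t s : WordTuple A} (h : Equiv L t s) : Bot L t ↔ Bot L s := by
  match t, s, h with
  | single u, single v, _ => simp [bot_single]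
  | single u, snoc s y, h => exact (not_equiv_single_snoc L u s y h).elim
  | snoc s y, single u, h => exact (not_equiv_snoc_single L u s y h).elim
  | snoc t z, snoc s y, h =>
      have := ((equiv_snoc L t s z y).1 h).2 []
      simpa [not_iff_not] using this

theorem equiv_concat : ∀ {t s : WordTuple A}, Equiv L t s → ∀ v : List A,
    Equiv L (t.concat v) (s.concat v)
  | single u, single u', h, v => by
      simp only [concat]
      rw [equiv_single] at h ⊢
      intro w
      simpa [Stream'.append_append_stream] using h (Stream'.appendStream' v w)
  | single u, snoc s y, h, _ => (not_equiv_single_snoc L u s y h).elim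
  | snoc s y, single u, h, _ => (not_equiv_snoc_single L u s y h).elim
  | snoc t z, snoc s y, h, v => by
      simp only [concat]
      rw [equiv_snoc] at h ⊢
      refine ⟨?_, fun w => by simpa using h.2 (v ++ w)⟩
      have := equiv_concat h.1 v
      rwa [concat_concat, concat_concat] at this
termination_by t => t.length
decreasing_by simp [length_concat, length]

theorem equiv_merge {t s : WordTuple A} (h : Equiv L t s) : Equiv L t.merge s.merge := by
  match t, s, h with
  | single u, single v, h => exact h
  | single u, snoc s y, h => exact (not_equiv_single_snoc L u s y h).elim
  | snoc s y, single u, h => exact (not_equiv_snoc_single L u s y h).elim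
  | snoc t z, snoc s y, h => exact ((equiv_snoc L t s z y).1 h).1

theorem bot_concat : ∀ {t : WordTuple A}, Bot L t → ∀ v : List A, Bot L (t.concat v)
  | single u, h, _ => (bot_single L u h).elim
  | snoc t z, h, v => by
      simp only [concat]
      rw [bot_snoc] at h ⊢
      rcases h with h | h
      · left
        have := bot_concat h v
        rwa [concat_concat] at this
      · right
        intro w hw e
        have := h (v ++ w) (by simp [hw]) (by simpa using e)
        rwa [← lasso_append] at this
termination_by t => t.length
decreasing_by simp [length_concat, length]

theorem not_bot_of_pointed {t : WordTuple A} (h : Pointed L t) : ¬ Bot L t := by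
  cases t with
  | single u => exact bot_single L u
  | snoc t z => exact ((pointed_snoc L t z).1 h).1

theorem pointed_concat {t : WordTuple A} (h : Pointed L t) {v : List A}
    (hv : ¬ Bot L (t.concat v)) : Pointed L (t.concat v) := by
  cases t with
  | single u => exact pointed_single L _
  | snoc t z =>
      simp only [concat] at hv ⊢
      rw [pointed_snoc] at h ⊢
      refine ⟨hv, h.2.1, fun s hs ps y e nb => ?_⟩
      have nb' : ¬ Bot L (snoc s (y ++ z)) := fun b => nb <| by
        simpa [concat] using bot_concat b v
      simpa [concat] using equiv_concat (h.2.2 s hs ps y e nb') v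

theorem pointed_merge {t : WordTuple A} (h : Pointed L t) : Pointed L t.merge := by
  cases t with
  | single u => exact h
  | snoc t z =>
      rw [pointed_snoc] at h
      exact pointed_concat h.2.1 fun b => h.1 ((bot_snoc L t z).2 (Or.inl b))

end facts

/-! ### The automaton of the congruence -/

/-- The congruence `≈` on tuples. -/
def tupleSetoid (L : Set (Stream' A)) : Setoid (WordTuple A) where
  r := Equiv L
  iseqv := ⟨equiv_refl, equiv_symm, equiv_trans⟩

/-- The `≈`-classes of tuples. -/
abbrev TupleClass (L : Set (Stream' A)) : Type u := Quotient (tupleSetoid L)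

namespace TupleClass

variable {L : Set (Stream' A)}

def length (c : TupleClass L) : ℕ :=
  Quotient.lift WordTuple.length (fun _ _ h => length_eq_of_equiv h) c

def IsBot (c : TupleClass L) : Prop :=
  Quotient.lift (Bot L) (fun _ _ h => propext (bot_congr h)) c

def concat (c : TupleClass L) (v : List A) : TupleClass L :=
  Quotient.map (fun t => t.concat v) (fun _ _ h => equiv_concat h v) c

def merge (c : TupleClass L) : TupleClass L :=
  Quotient.map WordTuple.merge (fun _ _ h => equiv_merge h) c

/-- The class contains a pointed tuple. -/
def IsPointed (c : TupleClass L) : Prop := ∃ t : WordTuple A, Pointed L t ∧ ⟦t⟧ = c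

theorem isPointed_concat {c : TupleClass L} (h : c.IsPointed) {v : List A}
    (hv : ¬ (c.concat v).IsBot) : (c.concat v).IsPointed := by
  obtain ⟨t, ht, rfl⟩ := h
  exact ⟨t.concat v, pointed_concat ht hv, rfl⟩

theorem isPointed_merge {c : TupleClass L} (h : c.IsPointed) : c.merge.IsPointed := by
  obtain ⟨t, ht, rfl⟩ := h
  exact ⟨t.merge, pointed_merge ht, rfl⟩

end TupleClass

open Classical in
/-- The automaton of the congruence `≈`: the states on layer `x` are the classes of the pointed
tuples of length `x`, the transitions are given by concatenation to the last component (undefined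
if this leads to `⊥`), the parent maps by merging the last two components, and the initial state
is the class of the tuple `(ε)`. -/
noncomputable def congruenceAutomaton (L : Set (Stream' A)) : LayeredData.{u, u} A where
  State := {c : TupleClass L // c.IsPointed}
  layer c := c.1.length
  next c a := if h : (c.1.concat [a]).IsBot then none
    else some ⟨c.1.concat [a], TupleClass.isPointed_concat c.2 h⟩
  parent c := ⟨c.1.merge, TupleClass.isPointed_merge c.2⟩
  start := ⟨⟦single []⟧, single [], pointed_single L [], rfl⟩

end LayeredAut

namespace LayeredAut

open Filter

universe u v

/-! ### Least limits of bounded sequences of priorities -/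

/-! Fix a deterministic parity automaton `B` for the language. The relation `≈` is controlled by the
states of `B` and the least priorities it sees on finite words.

Finiteness: whether `(t, z w) ≈ ⊥` depends, for given `w`, only on the classes of `t` and `t · z`
and on the effect of `z` on `B`, so each length has finitely many classes (`finite_classes`). A
component may be appended without reaching `⊥` only if some loop has an omega-power accepted against
the parity of the current length. Each component thus raises a lower bound on the priorities of
loops (`exists_loopBound`), which bounds the length of tuples other than `⊥`.

The core is `mem_iff_even_length`: a word strongly safe from a pointed tuple is accepted exactly if
the length of the tuple is even. If the least recurring priority of `B` had the other parity,
recurrence of a pair (class, state of `B`) would make a suffix safe from a tuple `(s, ε)` one layer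
deeper. That tuple need not be pointed, but `exists_pointed_safe` replaces it by a pointed one after
reading further letters, contradicting strong safety.

Consistency follows, as the layer parities of both states must agree with membership of the same
word. For recognition, each player, when choosing, moves below a state of the next layer from which
the rest of the word is safe, if there is one. If the least recurring priority `x` belongs to a
player moving like this, the run on layer `x` is eventually strongly safe, so `x` has the right
parity (`mem_iff_even_of_run`). Eve wins with this rule on words of `L`, and Adam refutes any
strategy of Eve with it on the others. -/

theorem parity_iff_even {p : ℕ → ℕ} {x : ℕ} (h : ∀ᶠ i in atTop, x ≤ p i)
    (h' : ∃ᶠ i in atTop, p i = x) : Parity p ↔ Even x := by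
  refine ⟨?_, fun e => ⟨x, e, h, h'⟩⟩
  rintro ⟨y, ey, k, k'⟩
  obtain ⟨i, hi, hi'⟩ := (h'.and_eventually k).exists
  obtain ⟨j, hj, hj'⟩ := (k'.and_eventually h).exists
  have : x = y := by omega
  exact this ▸ ey

theorem exists_frequently_eq {κ : Type*} {S : Set κ} (hS : S.Finite) {f : ℕ → κ}
    (hf : ∀ n, f n ∈ S) : ∃ c, ∃ᶠ n in atTop, f n = c := by
  by_contra! hc
  obtain ⟨i, hi⟩ := (hS.eventually_all.2 fun x _ => hc x).exists
  exact hi _ (hf i) rfl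

theorem exists_liminf {p : ℕ → ℕ} {D : ℕ} (h : ∀ i, p i ≤ D) :
    ∃ x, (∀ᶠ i in atTop, x ≤ p i) ∧ ∃ᶠ i in atTop, p i = x := by
  classical
  have ex : ∃ x, ∃ᶠ i in atTop, p i = x := exists_frequently_eq (Set.finite_Iic D) h
  refine ⟨Nat.find ex, ?_, Nat.find_spec ex⟩
  have : ∀ᶠ i in atTop, ∀ x ∈ Set.Iio (Nat.find ex), ¬ p i = x :=
    (Set.finite_Iio _).eventually_all.2 fun x hx => not_frequently.1 (Nat.find_min ex hx)
  filter_upwards [this] with i hi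
  by_contra! hlt
  exact hi _ hlt rfl

theorem parity_add (p : ℕ → ℕ) (n : ℕ) : Parity (fun i => p (n + i)) ↔ Parity p := by
  unfold Parity
  conv_rhs => rw [← map_add_atTop_eq_nat n]
  simp only [eventually_map, frequently_map, add_comm n]

/-- The parity condition can be checked on the minima of blocks of equal length. -/
theorem parity_blocks {p m : ℕ → ℕ} {n : ℕ} (hn : 0 < n)
    (hle : ∀ k, ∀ j < n, m k ≤ p (k * n + j)) (hex : ∀ k, ∃ j < n, p (k * n + j) = m k) :
    Parity p ↔ Parity m := by
  have split : ∀ i, i / n * n + i % n = i := fun i => Nat.div_add_mod' i n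
  have ge : ∀ i, m (i / n) ≤ p i := fun i => by
    have := hle (i / n) (i % n) (Nat.mod_lt i hn)
    rwa [split] at this
  have tend : Tendsto (fun i => i / n) atTop atTop := Nat.tendsto_div_const_atTop hn.ne'
  choose j hj hjm using hex
  have tend' : Tendsto (fun k => k * n + j k) atTop atTop :=
    tendsto_atTop_mono (fun k => le_add_right (Nat.le_mul_of_pos_right k hn)) tendsto_id
  have ev : ∀ x, (∀ᶠ i in atTop, x ≤ p i) ↔ ∀ᶠ k in atTop, x ≤ m k := fun x => by
    constructor
    · intro h
      filter_upwards [tend'.eventually h] with k hk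
      rwa [hjm] at hk
    · intro h
      filter_upwards [tend.eventually h] with i hi
      exact hi.trans (ge i)
  have fr : ∀ x, (∀ᶠ i in atTop, x ≤ p i) →
      ((∃ᶠ i in atTop, p i = x) ↔ ∃ᶠ k in atTop, m k = x) := fun x hx => by
    constructor
    · intro h
      refine tend.frequently ((h.and_eventually (tend.eventually ((ev x).1 hx))).mono ?_)
      rintro i ⟨h1, h2⟩
      exact le_antisymm ((ge i).trans h1.le) h2
    · intro h
      exact tend'.frequently (h.mono fun k hk => (hjm k).trans hk)
  unfold Parity
  constructor
  · rintro ⟨x, e, h, h'⟩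
    exact ⟨x, e, (ev x).1 h, (fr x h).1 h'⟩
  · rintro ⟨x, e, h, h'⟩
    exact ⟨x, e, (ev x).2 h, (fr x ((ev x).2 h)).2 h'⟩

/-! ### Periodic words -/

section streams

variable {A : Type u}

theorem cycle_congr {l l' : List A} (h : l ≠ []) (e : l = l') :
    Stream'.cycle l h = Stream'.cycle l' (e ▸ h) := by
  subst e
  rfl

theorem eq_cycle {l : List A} (h : l ≠ []) {x : Stream' A}
    (hx : Stream'.appendStream' l x = x) : x = Stream'.cycle l h := by
  have hl : 0 < l.length := List.length_pos_iff.2 h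
  refine Stream'.ext fun n => ?_
  induction n using Nat.strong_induction_on with
  | _ n ih =>
    rw [← hx, Stream'.cycle_eq]
    rcases lt_or_ge n l.length with hn | hn
    · rw [Stream'.get_append_left _ _ _ hn, Stream'.get_append_left _ _ _ hn]
    · obtain ⟨k, rfl⟩ := Nat.exists_eq_add_of_le hn
      rw [Stream'.get_append_right, Stream'.get_append_right]
      exact ih k (by omega)

theorem append_cycle (a b : List A) (h : b ++ a ≠ []) (h' : a ++ b ≠ []) :
    Stream'.appendStream' a (Stream'.cycle (b ++ a) h) = Stream'.cycle (a ++ b) h' := by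
  apply eq_cycle
  conv_rhs => rw [Stream'.cycle_eq]
  simp only [Stream'.append_append_stream]

end streams

/-! ### Runs of deterministic parity automata -/

namespace DPA

variable {A : Type u} {d : ℕ} (B : DPA A d)

/-- The state reached from `b` over a finite word. -/
def run (b : B.State) (v : List A) : B.State := v.foldl B.next b

/-- The priorities of the run over `w` from `b`. -/
def prios (b : B.State) (w : Stream' A) (i : ℕ) : ℕ := B.prio (B.run b (w.take i)) (w.get i)

/-- The language of the state `b`. -/
def languageFrom (b : B.State) : Set (Stream' A) := {w | Parity (B.prios b w)}

/-- The least priority on the run over a finite word, or `d + 1` for the empty word. -/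
def minPrio : B.State → List A → ℕ
  -- The value exceeds all priorities, so it is neutral for `min` and concatenation needs no case
  -- split on empty words.
  | _, [] => d + 1
  | b, a :: v => min (B.prio b a) (minPrio (B.next b a) v)

@[simp] theorem run_nil (b : B.State) : B.run b [] = b := rfl

theorem run_append (b : B.State) (v w : List A) : B.run b (v ++ w) = B.run (B.run b v) w :=
  List.foldl_append

theorem stateAt_eq (w : Stream' A) (n : ℕ) : B.stateAt w n = B.run B.start (w.take n) := by
  induction n with
  | zero => rfl
  | succ n ih => rw [Stream'.take_succ', run_append, stateAt, ih]; rfl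

theorem language_eq : B.language = B.languageFrom B.start := by
  simp only [language, stateAt_eq]
  rfl

theorem prios_add (b : B.State) (w : Stream' A) (n i : ℕ) :
    B.prios b w (n + i) = B.prios (B.run b (w.take n)) (w.drop n) i := by
  simp only [prios, Stream'.take_add, run_append, Stream'.get_drop]

theorem drop_mem_languageFrom (b : B.State) (w : Stream' A) (n : ℕ) :
    w.drop n ∈ B.languageFrom (B.run b (w.take n)) ↔ w ∈ B.languageFrom b := by
  have := parity_add (B.prios b w) n
  simp only [prios_add] at this
  exact this

theorem _root_.LayeredAut.take_append_length (v : List A) (w : Stream' A) :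
    (Stream'.appendStream' v w).take v.length = v := by
  simpa using (Stream'.append_take 0 v w).symm

theorem append_mem_languageFrom (b : B.State) (v : List A) (w : Stream' A) :
    Stream'.appendStream' v w ∈ B.languageFrom b ↔ w ∈ B.languageFrom (B.run b v) := by
  rw [← B.drop_mem_languageFrom b _ v.length, Stream'.drop_append_stream,
    take_append_length]

theorem append_mem_language (v : List A) (w : Stream' A) :
    Stream'.appendStream' v w ∈ B.language ↔ w ∈ B.languageFrom (B.run B.start v) := by
  rw [language_eq, append_mem_languageFrom]

theorem prios_mem (b : B.State) (w : Stream' A) (i : ℕ) : B.prios b w i ∈ Set.Icc 1 d :=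
  B.prio_mem _ _

theorem minPrio_append (b : B.State) (v w : List A) :
    B.minPrio b (v ++ w) = min (B.minPrio b v) (B.minPrio (B.run b v) w) := by
  induction v generalizing b with
  | nil =>
    have : B.minPrio b w ≤ d + 1 := by
      cases w with
      | nil => exact le_rfl
      | cons a w => exact (min_le_left _ _).trans ((B.prio_mem b a).2.trans (Nat.le_succ d))
    simpa [minPrio] using this
  | cons a v ih =>
    simp only [List.cons_append, minPrio, ih, min_assoc]
    rfl

theorem minPrio_take_le (w : Stream' A) {j n : ℕ} (h : j < n) (b : B.State) :
    B.minPrio b (w.take n) ≤ B.prios b w j := by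
  obtain ⟨k, rfl⟩ := Nat.exists_eq_add_of_lt h
  rw [add_assoc, add_comm k, ← add_assoc, Stream'.take_add, Stream'.take_succ', minPrio_append,
    minPrio_append]
  exact (min_le_left _ _).trans ((min_le_right _ _).trans (min_le_left _ _))

theorem exists_prios_eq_minPrio (w : Stream' A) (n : ℕ) (hn : 0 < n) (b : B.State) :
    ∃ j < n, B.prios b w j = B.minPrio b (w.take n) := by
  induction n, hn using Nat.le_induction with
  | base =>
    refine ⟨0, one_pos, ?_⟩
    have := (B.prios_mem b w 0).2
    simp only [prios, Stream'.take_zero, run_nil] at this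
    simp [prios, minPrio, Stream'.take_succ, Stream'.head]
    omega
  | succ n hn ih =>
    obtain ⟨j, hj, e⟩ := ih
    have hb := (B.prios_mem b w n).2
    rw [Stream'.take_succ', minPrio_append, ← e]
    have : B.minPrio (B.run b (w.take n)) [w.get n] = B.prios b w n := by
      simp only [prios] at hb
      simp only [minPrio, prios]
      omega
    rw [this]
    rcases le_total (B.prios b w j) (B.prios b w n) with h | h
    · exact ⟨j, by omega, (min_eq_left h).symm⟩
    · exact ⟨n, by omega, (min_eq_right h).symm⟩

theorem le_minPrio_take (w : Stream' A) {n : ℕ} (hn : 0 < n) (b : B.State) {x : ℕ}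
    (h : ∀ j < n, x ≤ B.prios b w j) : x ≤ B.minPrio b (w.take n) := by
  obtain ⟨j, hj, e⟩ := B.exists_prios_eq_minPrio w n hn b
  exact e ▸ h j hj

theorem one_le_minPrio (b : B.State) (v : List A) : 1 ≤ B.minPrio b v := by
  induction v generalizing b with
  | nil => simp [minPrio]
  | cons a v ih => exact le_min (B.prio_mem _ _).1 (ih _)

/-! ### Iterated periods and the finite effect of a word on `B` -/

/-- The state reached from `b` after reading `l` exactly `k` times. -/
def iter (b : B.State) (l : List A) (k : ℕ) : B.State := (fun c => B.run c l)^[k] b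

theorem iter_succ (b : B.State) (l : List A) (k : ℕ) :
    B.iter b l (k + 1) = B.run (B.iter b l k) l :=
  Function.iterate_succ_apply' _ _ _

theorem take_cycle (l : List A) (h : l ≠ []) : (Stream'.cycle l h).take l.length = l := by
  rw [Stream'.cycle_eq, take_append_length]

theorem drop_cycle (l : List A) (h : l ≠ []) (k : ℕ) :
    (Stream'.cycle l h).drop (k * l.length) = Stream'.cycle l h := by
  induction k with
  | zero => simp
  | succ k ih =>
    rw [Nat.succ_mul, ← Stream'.drop_drop, ih]
    conv_lhs => rw [Stream'.cycle_eq, Stream'.drop_append_stream]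

theorem run_take_cycle (b : B.State) (l : List A) (h : l ≠ []) (k : ℕ) :
    B.run b ((Stream'.cycle l h).take (k * l.length)) = B.iter b l k := by
  induction k with
  | zero => simp [iter]
  | succ k ih =>
    rw [Nat.succ_mul, Stream'.take_add, run_append, ih, drop_cycle, take_cycle, iter_succ]

/-- Membership of a periodic word depends only on the states and the least priorities of the
periods. -/
theorem cycle_mem_languageFrom (b : B.State) (l : List A) (h : l ≠ []) :
    Stream'.cycle l h ∈ B.languageFrom b ↔ Parity fun k => B.minPrio (B.iter b l k) l := by
  have hl : 0 < l.length := List.length_pos_iff.2 h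
  have key : ∀ k j, B.prios b (Stream'.cycle l h) (k * l.length + j) =
      B.prios (B.iter b l k) (Stream'.cycle l h) j := fun k j => by
    rw [prios_add, drop_cycle, run_take_cycle]
  refine parity_blocks hl (fun k j hj => ?_) fun k => ?_
  · have := B.minPrio_take_le (Stream'.cycle l h) hj (B.iter b l k)
    rwa [take_cycle, ← key] at this
  · obtain ⟨j, hj, e⟩ := B.exists_prios_eq_minPrio (Stream'.cycle l h) _ hl (B.iter b l k)
    exact ⟨j, hj, by rw [key, e, take_cycle]⟩

theorem lasso_mem_language (u z w : List A) (hw : w ≠ []) :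
    lasso u z w hw ∈ B.language ↔
      Parity fun k => B.minPrio (B.iter (B.run B.start u) (z ++ w) k) (z ++ w) := by
  rw [lasso, append_mem_language, cycle_mem_languageFrom]

theorem iter_eq_self {b : B.State} {l : List A} (h : B.run b l = b) (k : ℕ) :
    B.iter b l k = b :=
  Function.iterate_fixed h k

/-- The effect of a finite word: the states reached and the least priorities visited. -/
def profile (v : List A) (b : B.State) : B.State × Fin (d + 2) :=
  -- The cap only provides the bound required by `Fin`; by `minPrio_le` it never changes the value.
  (B.run b v, ⟨min (B.minPrio b v) (d + 1), by omega⟩)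

theorem minPrio_le (b : B.State) (v : List A) : B.minPrio b v ≤ d + 1 := by
  have := B.minPrio_append b [] v
  simp only [List.nil_append, minPrio, run_nil] at this
  omega

theorem profile_eq_iff {v w : List A} :
    B.profile v = B.profile w ↔
      ∀ b, B.run b v = B.run b w ∧ B.minPrio b v = B.minPrio b w := by
  simp only [funext_iff, profile, Prod.mk.injEq, Fin.mk.injEq, minPrio_le, min_eq_left]

theorem profile_append {v w : List A} (h : B.profile v = B.profile w) (x : List A) :
    B.profile (v ++ x) = B.profile (w ++ x) := by
  rw [profile_eq_iff] at h ⊢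
  intro b
  simp only [run_append, minPrio_append, (h b).1, (h b).2, and_self]

theorem lasso_congr {z z' : List A} (h : B.profile z = B.profile z') (u w : List A)
    (hw : w ≠ []) : lasso u z w hw ∈ B.language ↔ lasso u z' w hw ∈ B.language := by
  have h := B.profile_eq_iff.1 (B.profile_append h w)
  rw [lasso_mem_language, lasso_mem_language]
  simp only [iter, h]

end DPA

/-! ### Finiteness of the congruence -/

section congruence

open WordTuple

variable {A : Type u} {L : Set (Stream' A)}

theorem WordTuple.word_concat (t : WordTuple A) (v : List A) :
    (t.concat v).word = t.word ++ v := by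
  cases t <;> simp [concat, word]

@[simp] theorem WordTuple.concat_nil (t : WordTuple A) : t.concat [] = t := by
  cases t <;> simp [concat]

theorem WordTuple.length_pos (t : WordTuple A) : 0 < t.length := by
  cases t <;> simp [length]

/-- Equivalent tuples have residual equivalent concatenations. -/
theorem equiv_residual : ∀ {t s : WordTuple A}, Equiv L t s → ∀ w : Stream' A,
    Stream'.appendStream' t.word w ∈ L ↔ Stream'.appendStream' s.word w ∈ L
  | single u, single v, h => (equiv_single L u v).1 h
  | single u, snoc s y, h => (not_equiv_single_snoc L u s y h).elim
  | snoc s y, single u, h => (not_equiv_snoc_single L u s y h).elim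
  | snoc t z, snoc s y, h => by
      have := equiv_residual ((equiv_snoc L t s z y).1 h).1
      simp only [word_concat] at this
      exact this
termination_by t => t.length
decreasing_by simp [length_concat, length]

theorem single_equiv {u v : List A} (h : ∀ w : Stream' A, Stream'.appendStream' u w ∈ L ↔
    Stream'.appendStream' v w ∈ L) : Equiv L (single u) (single v) :=
  (equiv_single L u v).2 h

variable {d : ℕ} (B : DPA A d)

/-- Unfolding `⊥`, the component `z` enters through the class of `t · z` and through lassos with
period `z w`; for the latter only the profile of `z` matters. -/
theorem bot_snoc_congr {t t' : WordTuple A} {z z' : List A} (h : Equiv B.language t t')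
    (h' : Equiv B.language (t.concat z) (t'.concat z')) (hz : B.profile z = B.profile z') :
    Bot B.language (snoc t z) ↔ Bot B.language (snoc t' z') := by
  rw [bot_snoc, bot_snoc, bot_congr h', length_eq_of_equiv h]
  refine or_congr Iff.rfl (forall_congr' fun w => forall_congr' fun hw => ?_)
  have e : Equiv B.language (t.concat (z ++ w)) (t'.concat (z' ++ w)) := by
    simpa only [concat_concat] using equiv_concat h' w
  have e1 : Equiv B.language (t.concat (z ++ w)) t ↔ Equiv B.language (t'.concat (z' ++ w)) t' :=
    ⟨fun k => equiv_trans (equiv_symm e) (equiv_trans k h),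
      fun k => equiv_trans e (equiv_trans k (equiv_symm h))⟩
  have e2 : lasso t.word z w hw ∈ B.language ↔ lasso t'.word z' w hw ∈ B.language :=
    (equiv_residual h _).trans (B.lasso_congr hz t'.word w hw)
  rw [e1, e2]

theorem equiv_snoc_of_profile {t t' : WordTuple A} {z z' : List A} (h : Equiv B.language t t')
    (h' : Equiv B.language (t.concat z) (t'.concat z')) (hz : B.profile z = B.profile z') :
    Equiv B.language (snoc t z) (snoc t' z') := by
  refine (equiv_snoc _ _ _ _ _).2 ⟨h', fun w => not_congr (bot_snoc_congr B h ?_ ?_)⟩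
  · simpa only [concat_concat] using equiv_concat h' w
  · exact B.profile_append hz w

theorem finite_of_code {n : ℕ} {κ : Type*} {T : Set κ} (hT : T.Finite) (F : WordTuple A → κ)
    (hF : ∀ t : WordTuple A, t.length = n → F t ∈ T)
    (inj : ∀ t s : WordTuple A, t.length = n → s.length = n → F t = F s → Equiv L t s) :
    {c : TupleClass L | c.length = n}.Finite := by
  have len : ∀ c : TupleClass L, c.length = n → c.out.length = n := fun c hc => by
    rw [← hc]
    conv_rhs => rw [← c.out_eq]
    rfl
  refine Set.Finite.of_finite_image (f := fun c => F c.out) (hT.subset ?_) ?_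
  · rintro _ ⟨c, hc, rfl⟩
    exact hF _ (len c hc)
  · intro c hc c' hc' e
    have := inj _ _ (len c hc) (len c' hc') e
    rw [← c.out_eq, ← c'.out_eq]
    exact Quotient.sound this

/-- A tuple `(t, z)` is coded by the classes of `t` and `t · z`, finitely many by induction, and the
profile of `z`. For length one, the state of `B` determines the residual. -/
theorem finite_classes (n : ℕ) : {c : TupleClass B.language | c.length = n}.Finite := by
  have := B.finite
  induction n with
  | zero =>
    exact finite_of_code Set.finite_univ (fun _ => ()) (fun _ _ => trivial)
      fun t _ h => absurd h t.length_pos.ne'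
  | succ n ih =>
    rcases Nat.eq_zero_or_pos n with rfl | hn
    · refine finite_of_code Set.finite_univ (fun t => B.run B.start t.word) (fun _ _ => trivial) ?_
      rintro (u | ⟨t, z⟩) (v | ⟨s, y⟩) ht hs e
      · refine single_equiv fun w => ?_
        rw [DPA.append_mem_language, DPA.append_mem_language]
        exact iff_of_eq (congrArg (fun b => w ∈ B.languageFrom b) e)
      · exact absurd hs (by have := s.length_pos; simp only [length]; omega)
      · exact absurd ht (by have := t.length_pos; simp only [length]; omega)
      · exact absurd ht (by have := t.length_pos; simp only [length]; omega)
    · let F : WordTuple A → TupleClass B.language × TupleClass B.language ×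
          (B.State → B.State × Fin (d + 2)) := fun t => match t with
        | single u => (⟦single u⟧, ⟦single u⟧, B.profile u)
        | snoc t z => (⟦t⟧, ⟦t.concat z⟧, B.profile z)
      refine finite_of_code (ih.prod (ih.prod Set.finite_univ)) F ?_ ?_
      · rintro (u | ⟨t, z⟩) ht
        · simp only [length] at ht
          omega
        · have ht : t.length = n := by simpa [length] using ht
          exact ⟨ht, (length_concat t z).trans ht, trivial⟩
      · rintro (u | ⟨t, z⟩) (v | ⟨s, y⟩) ht hs e
        · simp only [length] at ht
          omega
        · simp only [length] at ht
          omega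
        · simp only [length] at hs
          omega
        · simp only [F, Prod.mk.injEq] at e
          exact equiv_snoc_of_profile B (Quotient.exact e.1) (Quotient.exact e.2.1) e.2.2

/-! ### Tuples different from `⊥` have bounded length -/

/-- Take a loop minimising the sum over all states of the least priorities: continuing it by a loop
that sees a smaller priority from some state would lower the sum. -/
theorem exists_loop_le_minPrio (t : WordTuple A) : ∃ v, Equiv B.language (t.concat v) t ∧
    ∀ b v', Equiv B.language ((t.concat v).concat v') t →
      B.minPrio b v ≤ B.minPrio (B.run b v) v' := by
  have := B.finite
  have := Fintype.ofFinite B.State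
  obtain ⟨v, hv, hmin⟩ := exists_minimalFor_of_wellFoundedLT
    (fun v => Equiv B.language (t.concat v) t) (fun v => ∑ b, B.minPrio b v)
    ⟨[], by simpa using equiv_refl t⟩
  refine ⟨v, hv, fun b v' h => ?_⟩
  by_contra! hlt
  rw [concat_concat] at h
  have le : ∀ c, B.minPrio c (v ++ v') ≤ B.minPrio c v := fun c =>
    (B.minPrio_append c v v').trans_le (min_le_left _ _)
  have lt : B.minPrio b (v ++ v') < B.minPrio b v :=
    (B.minPrio_append b v v').trans_lt ((min_le_right _ _).trans_lt hlt)
  have := Finset.sum_lt_sum (fun c _ => le c) ⟨b, Finset.mem_univ b, lt⟩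
  exact absurd (hmin h this.le) (not_le.2 this)

/-- The state `b` is residual equivalent to `t`, and all the loops on `t` have only priorities
that are at least the length of `t` when they are read from `b`. -/
def LoopBound (t : WordTuple A) (b : B.State) : Prop :=
  (∀ w, w ∈ B.languageFrom b ↔ Stream'.appendStream' t.word w ∈ B.language) ∧
    ∀ v, Equiv B.language (t.concat v) t → t.length ≤ B.minPrio b v

theorem LoopBound.run {t : WordTuple A} {b : B.State} (h : LoopBound B t b) {v : List A}
    (hv : Equiv B.language (t.concat v) t) : LoopBound B t (B.run b v) := by
  refine ⟨fun w => ?_, fun v' hv' => ?_⟩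
  · rw [← B.append_mem_languageFrom, h.1, ← Stream'.append_append_stream, ← word_concat]
    exact equiv_residual hv w
  · have := h.2 (v ++ v') (by
      rw [← concat_concat]
      exact equiv_trans (equiv_concat hv v') hv')
    rw [B.minPrio_append] at this
    exact this.trans (min_le_right _ _)

/-- Extend `(s, z)` by the loop `v` of `exists_loop_le_minPrio`. As the result is not `⊥`, some `z v
w` is a loop on `s` whose power has the parity opposite to the length of `s`. Iterated from a state
good for `s`, it only sees priorities at least that length, and its recurring minimum has the other
parity, hence is larger. A late state after `z v` is then good for `(s, z)`: `v` has seen only large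
priorities, and later loops cannot go lower. -/
theorem exists_loopBound (t : WordTuple A) (ht : ¬ Bot B.language t) : ∃ b, LoopBound B t b := by
  induction t with
  | single u =>
    exact ⟨B.run B.start u, fun w => (B.append_mem_language u w).symm,
      fun v _ => B.one_le_minPrio _ v⟩
  | snoc s z ih =>
    obtain ⟨b, hb⟩ := ih fun h => ht ((bot_snoc _ _ _).2 (.inl (bot_concat h z)))
    obtain ⟨v, hv, hmin⟩ := exists_loop_le_minPrio B (snoc s z)
    have nb := mt (bot_congr hv).1 ht
    simp only [concat, bot_snoc, not_or, not_forall] at nb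
    obtain ⟨-, w, hw, e, par⟩ := nb
    rw [lasso, ← hb.1, B.cycle_mem_languageFrom] at par
    set l := z ++ v ++ w with hl
    have hk : ∀ k, LoopBound B s (B.iter b l k) := fun k => by
      induction k with
      | zero => exact hb
      | succ k ih => rw [B.iter_succ]; exact ih.run B e
    obtain ⟨y, ev, fr⟩ := exists_liminf fun k => B.minPrio_le (B.iter b l k) l
    rw [parity_iff_even ev fr] at par
    have hy : s.length + 1 ≤ y := by
      obtain ⟨k, hk'⟩ := fr.exists
      refine lt_of_le_of_ne (hk' ▸ (hk k).2 l e) ?_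
      rintro rfl
      exact par Iff.rfl
    obtain ⟨k, hk'⟩ := ev.exists
    have le := hy.trans hk'
    rw [hl, B.minPrio_append, B.minPrio_append] at le
    refine ⟨B.run (B.iter b l k) (z ++ v), fun x => ?_, fun v' hv' => ?_⟩
    · rw [← B.append_mem_languageFrom, (hk k).1, ← Stream'.append_append_stream]
      exact equiv_residual hv x
    · rw [B.run_append]
      refine le_trans ?_ (hmin _ v' (equiv_trans (equiv_concat hv v') hv'))
      exact le.trans ((min_le_left _ _).trans (min_le_right _ _))

theorem length_le (t : WordTuple A) (ht : ¬ Bot B.language t) : t.length ≤ d + 1 := by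
  obtain ⟨b, hb⟩ := exists_loopBound B t ht
  -- The empty word is a loop, and its `minPrio` is the default `d + 1`.
  exact hb.2 [] (by simpa using equiv_refl t)

end congruence

/-! ### Existence of pointed tuples -/

section pointed

open WordTuple

variable {A : Type u} {L : Set (Stream' A)}

theorem lasso_rotate (u y z w : List A) (hw : w ≠ []) :
    lasso u (y ++ z) w hw = lasso (u ++ y) z (w ++ y) (by simp [hw]) := by
  simp only [lasso, Stream'.append_append_stream]
  rw [cycle_congr (l := z ++ (w ++ y)) (by simp [hw]) (List.append_assoc z w y).symm,
    append_cycle y (z ++ w) _ (by simp [hw]), cycle_congr _ (List.append_assoc y z w)]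

/-- A longer history leads to a smaller safe language. -/
theorem bot_of_history {r s : WordTuple A} {y z : List A} (h : Equiv L (r.concat y) s)
    (hb : Bot L (snoc s z)) : Bot L (snoc r (y ++ z)) := by
  have hz : ∀ v, Equiv L (r.concat (y ++ v)) (s.concat v) := fun v => by
    simpa only [concat_concat] using equiv_concat h v
  rw [bot_snoc] at hb ⊢
  refine hb.imp (bot_congr (hz z)).2 fun H w hw e => ?_
  have len : r.length = s.length := by simpa only [length_concat] using length_eq_of_equiv h
  -- A loop `y z w` on `r` rotates to a loop `z w y` on `s`, and both spell the same infinite word.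
  have e' : Equiv L (s.concat (z ++ (w ++ y))) s := by
    refine equiv_trans (equiv_symm (hz _)) (equiv_trans ?_ h)
    simpa only [concat_concat, List.append_assoc] using equiv_concat e y
  rw [lasso_rotate, len, ← H (w ++ y) (by simp [hw]) e', ← word_concat]
  exact equiv_residual h _

/-- The run over `w` from `t` never reaches `⊥`. -/
def SafeFrom (L : Set (Stream' A)) (t : WordTuple A) (w : Stream' A) : Prop :=
  ∀ n, ¬ Bot L (t.concat (w.take n))

theorem SafeFrom.drop {t : WordTuple A} {w : Stream' A} (h : SafeFrom L t w) (n : ℕ) :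
    SafeFrom L (t.concat (w.take n)) (w.drop n) := fun m => by
  rw [concat_concat, ← Stream'.take_add]
  exact h _

/-- The finite words that do not lead from `t` to `⊥`. -/
def safeWords (L : Set (Stream' A)) (t : WordTuple A) : Set (List A) :=
  {v | ¬ Bot L (t.concat v)}

theorem safeWords_congr {t s : WordTuple A} (h : Equiv L t s) : safeWords L t = safeWords L s :=
  Set.ext fun v => not_congr (bot_congr (equiv_concat h v))

theorem finite_safeWords {n : ℕ} (fin : {c : TupleClass L | c.length = n}.Finite) :
    {X | ∃ t : WordTuple A, t.length = n ∧ safeWords L t = X}.Finite := by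
  refine (fin.image fun c => safeWords L c.out).subset ?_
  rintro _ ⟨t, ht, rfl⟩
  exact ⟨⟦t⟧, ht, safeWords_congr (Quotient.mk_out (s := tupleSetoid L) t)⟩

/-- Among the candidates with pointed prefix from which `w` is safe, pick one with minimal safe
language, which exists by finiteness. If it never becomes pointed along `w`, every prefix of `w` has
a longer history violating the condition. A history whose class recurs is a candidate with a
smaller, hence equal, safe language, so it is equivalent after all. -/
theorem exists_pointed_safe (fin : ∀ n, {c : TupleClass L | c.length = n}.Finite)
    {s : WordTuple A} {z : List A} {w : Stream' A} (hs : Pointed L s)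
    (h : SafeFrom L (snoc s z) w) :
    ∃ n r y, Pointed L (snoc r y) ∧ r.length = s.length ∧
      Equiv L (r.concat y) (s.concat (z ++ w.take n)) ∧ SafeFrom L (snoc r y) (w.drop n) := by
  let P : Set (Set (List A)) := {X | ∃ r y, Pointed L r ∧ r.length = s.length ∧
    Equiv L (r.concat y) (s.concat z) ∧ SafeFrom L (snoc r y) w ∧ safeWords L (snoc r y) = X}
  have hP : P.Finite := (finite_safeWords (fin (s.length + 1))).subset <| by
    rintro X ⟨r, y, -, hl, -, -, e⟩
    exact ⟨snoc r y, by simp [length, hl], e⟩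
  obtain ⟨X, ⟨r, y, hr, hl, e, safe, rfl⟩, hmin⟩ :=
    hP.exists_minimal ⟨_, s, z, hs, rfl, equiv_refl _, h, rfl⟩
  by_cases hp : ∃ n, Pointed L (snoc r (y ++ w.take n))
  · obtain ⟨n, hn⟩ := hp
    refine ⟨n, r, _, hn, hl, ?_, safe.drop n⟩
    simpa only [concat_concat] using equiv_concat e (w.take n)
  exfalso
  push Not at hp
  have wit : ∀ n, ∃ (q : WordTuple A) (x : List A), q.length = r.length ∧ Pointed L q ∧
      Equiv L (q.concat x) r ∧ ¬ Bot L (snoc q (x ++ (y ++ w.take n))) ∧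
      ¬ Equiv L (snoc q (x ++ (y ++ w.take n))) (snoc r (y ++ w.take n)) := fun n => by
    have := hp n
    rw [pointed_snoc] at this
    push Not at this
    obtain ⟨q, h1, h2, x, h3, h4, h5⟩ := this (safe n) hr
    exact ⟨q, x, h1, h2, h3, h4, h5⟩
  choose q x hq1 hq2 hq3 hq4 hq5 using wit
  obtain ⟨c, hc⟩ := exists_frequently_eq (fin (r.length + 1))
    (f := fun n => (⟦snoc (q n) (x n ++ y)⟧ : TupleClass L)) fun n => by
      change (q n).length + 1 = _
      rw [hq1]
  obtain ⟨k, hk⟩ := hc.exists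
  -- The class recurs for arbitrarily long prefixes that avoid `⊥`, and `⊥` is never left once
  -- reached.
  have safe' : SafeFrom L (snoc (q k) (x k ++ y)) w := fun m hm => by
    obtain ⟨n, hn, hmn⟩ := (hc.and_eventually (eventually_ge_atTop m)).exists
    have e' : Equiv L (snoc (q n) (x n ++ y)) (snoc (q k) (x k ++ y)) :=
      Quotient.exact (hn.trans hk.symm)
    obtain ⟨j, rfl⟩ := Nat.exists_eq_add_of_le hmn
    refine hq4 (m + j) ?_
    have := bot_concat ((bot_congr (equiv_concat e' (w.take m))).2 hm) ((w.drop m).take j)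
    simpa only [concat, Stream'.take_add, List.append_assoc] using this
  have sub : safeWords L (snoc (q k) (x k ++ y)) ⊆ safeWords L (snoc r y) := fun v hv hb => by
    refine hv ?_
    simpa only [concat, List.append_assoc] using bot_of_history (hq3 k) hb
  have e' : Equiv L ((q k).concat (x k ++ y)) (r.concat y) := by
    simpa only [concat_concat] using equiv_concat (hq3 k) y
  have sup := hmin ⟨q k, x k ++ y, hq2 k, (hq1 k).trans hl, equiv_trans e' e, safe', rfl⟩ sub
  refine hq5 k ?_
  have : Equiv L (snoc (q k) (x k ++ y)) (snoc r y) :=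
    (equiv_snoc _ _ _ _ _).2 ⟨e', fun v => ⟨fun hv => sub hv, fun hv => sup hv⟩⟩
  simpa only [concat, List.append_assoc] using equiv_concat this (w.take k)

/-! ### The parity of strongly safe words -/

/-- If `w` is safe from a pointed tuple `t`, and no suffix of `w` is safe from a pointed tuple that
extends the tuple reached from `t`, then the length of `t` decides whether `w` is accepted. -/
theorem mem_iff_even_length {d : ℕ} (B : DPA A d) {t : WordTuple A} {w : Stream' A}
    (ht : Pointed B.language t) (safe : SafeFrom B.language t w)
    (strong : ∀ n s z, Pointed B.language (snoc s z) → s.length = t.length →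
      Equiv B.language (s.concat z) (t.concat (w.take n)) →
      ¬ SafeFrom B.language (snoc s z) (w.drop n)) :
    Stream'.appendStream' t.word w ∈ B.language ↔ Even t.length := by
  have := B.finite
  set b := B.run B.start t.word with hb
  obtain ⟨y, ev, fr⟩ := exists_liminf fun i => (B.prios_mem b w i).2
  have mem : Stream'.appendStream' t.word w ∈ B.language ↔ Even y := by
    rw [B.append_mem_language]
    exact parity_iff_even ev fr
  rw [mem]
  by_contra par
  obtain ⟨c, hc⟩ := exists_frequently_eq
    ((finite_classes B t.length).prod (Set.finite_univ (α := B.State)))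
    (f := fun n => (⟦t.concat (w.take n)⟧, B.run b (w.take n)))
    fun n => ⟨length_concat _ _, trivial⟩
  obtain ⟨N, hN⟩ := eventually_atTop.1 ev
  obtain ⟨n, hcn, hn⟩ := (hc.and_eventually (eventually_ge_atTop N)).exists
  set s := t.concat (w.take n) with hs
  have hsl : s.length = t.length := length_concat _ _
  -- A prefix of the remaining word extends, past an occurrence of `y`, to the next recurrence of
  -- `c`. This closes a loop on the class and on the state of `B`, with least priority exactly `y`,
  -- so its power witnesses that the prefix avoids `⊥`.
  have safe' : SafeFrom B.language (snoc s []) (w.drop n) := fun m => by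
    obtain ⟨i, hi, hmi⟩ := (fr.and_eventually (eventually_ge_atTop (n + m))).exists
    obtain ⟨j, hcj, hij⟩ := (hc.and_eventually (eventually_gt_atTop i)).exists
    obtain ⟨i, rfl⟩ : ∃ i', i = n + i' := ⟨i - n, by omega⟩
    obtain ⟨j, rfl⟩ : ∃ k, j = n + (m + k) := ⟨j - n - m, by omega⟩
    have hcc := hcj.trans hcn.symm
    rw [Prod.mk.injEq, Stream'.take_add, B.run_append, ← concat_concat, ← hs] at hcc
    set b' := B.run b (w.take n) with hb'
    have prio : ∀ k, B.prios b' (w.drop n) k = B.prios b w (n + k) := fun k =>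
      (B.prios_add b w n k).symm
    have hmin : B.minPrio b' ((w.drop n).take (m + j)) = y := by
      refine le_antisymm ?_ ?_
      · have := B.minPrio_take_le (w.drop n) (j := i) (n := m + j) (by omega) b'
        rwa [prio, hi] at this
      · refine B.le_minPrio_take _ (by omega) _ fun k _ => ?_
        rw [prio]
        exact hN _ (by omega)
    rw [Stream'.take_add] at hcc hmin
    set v := (w.drop n).take m with hv
    set x := ((w.drop n).drop m).take j with hx
    have hx' : x ≠ [] := fun h0 => by
      have := congrArg List.length h0
      rw [hx, Stream'.length_take, List.length_nil] at this
      omega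
    simp only [concat, List.nil_append, bot_snoc, not_or, not_forall]
    refine ⟨?_, x, hx', Quotient.exact hcc.1, ?_⟩
    · have := safe (n + m)
      rwa [Stream'.take_add, ← concat_concat] at this
    · have hrun : B.run B.start s.word = b' := by rw [hs, word_concat, B.run_append]
      simp only [B.lasso_mem_language, hrun, B.iter_eq_self hcc.2, hmin, hsl]
      rwa [parity_iff_even (x := y) (.of_forall fun _ => le_rfl) (.of_forall fun _ => rfl)]
  obtain ⟨m, r, z, hp, hl, e, hsafe⟩ := exists_pointed_safe (finite_classes B)
    (pointed_concat ht (safe n)) safe'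
  refine strong (n + m) r z hp (hl.trans hsl) ?_ ?_
  · rw [Stream'.take_add, ← concat_concat]
    simpa using e
  · rwa [Stream'.drop_drop] at hsafe

end pointed

/-! ### Layered automata -/

namespace LayeredData

variable {A : Type u} {M : LayeredData.{u, v} A} {d : ℕ}

theorem run_append (q : M.State) (v w : List A) :
    M.run q (v ++ w) = (M.run q v).bind fun q' => M.run q' w := by
  induction v generalizing q with
  | nil => rfl
  | cons a v ih =>
    simp only [List.cons_append, run, Option.bind_assoc]
    exact congrArg _ (funext fun q' => ih q')

theorem run_singleton (q : M.State) (a : A) : M.run q [a] = M.next q a := by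
  simp [run]

theorem run_take_succ {q q' : M.State} {w : Stream' A} {n : ℕ}
    (h : M.run q (w.take n) = some q') : M.run q (w.take (n + 1)) = M.next q' (w.get n) := by
  rw [Stream'.take_succ', run_append, h, Option.bind_some, run_singleton]

theorem Safe.drop {q q' : M.State} {w : Stream' A} (h : M.Safe q w) {n : ℕ}
    (hq : M.run q (w.take n) = some q') : M.Safe q' (w.drop n) := fun m => by
  have := h (n + m)
  rwa [Stream'.take_add, run_append, hq, Option.bind_some] at this

theorem ancestor_layer (q : M.State) : M.ancestor (M.layer q) q = q := by
  simp [ancestor]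

theorem parent_ancestor {q : M.State} {x : ℕ} (h : x + 1 ≤ M.layer q) :
    M.parent (M.ancestor (x + 1) q) = M.ancestor x q := by
  have : M.layer q - x = M.layer q - (x + 1) + 1 := by omega
  rw [ancestor, ancestor, this, Function.iterate_succ_apply']

theorem isPriority_unique {q : M.State} {a : A} {x y : ℕ} (hx : M.IsPriority q a x)
    (hy : M.IsPriority q a y) : x = y := hx.unique hy

namespace IsLayeredAutomaton

variable (hM : M.IsLayeredAutomaton d)
include hM

theorem layer_iterate (q : M.State) (k : ℕ) (h : k < M.layer q) :
    M.layer (M.parent^[k] q) + k = M.layer q := by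
  induction k with
  | zero => rfl
  | succ k ih =>
    have ih := ih (by omega)
    have := hM.layer_parent (M.parent^[k] q) (by omega)
    rw [Function.iterate_succ_apply']
    omega

theorem layer_ancestor {q : M.State} {x : ℕ} (hx : 1 ≤ x) (h : x ≤ M.layer q) :
    M.layer (M.ancestor x q) = x := by
  have := hM.layer_iterate q (M.layer q - x) (by omega)
  rw [ancestor]
  omega

theorem ancestor_ancestor {q : M.State} {x y : ℕ} (hx : 1 ≤ x) (hxy : x ≤ y)
    (h : y ≤ M.layer q) : M.ancestor x (M.ancestor y q) = M.ancestor x q := by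
  have e : M.layer q - x = (y - x) + (M.layer q - y) := by omega
  conv_lhs => rw [ancestor, hM.layer_ancestor (hx.trans hxy) h]
  rw [ancestor, ancestor, e, Function.iterate_add_apply]

theorem next_ancestor {q q' : M.State} {a : A} {x : ℕ} (h : M.next q a = some q') (hx : 1 ≤ x)
    (hxq : x ≤ M.layer q) : M.next (M.ancestor x q) a = some (M.ancestor x q') := by
  rw [ancestor, ancestor, hM.layer_next q a q' h]
  have : M.layer q - x < M.layer q := by omega
  generalize M.layer q - x = k at this
  induction k with
  | zero => exact h
  | succ k ih =>
    rw [Function.iterate_succ_apply', Function.iterate_succ_apply']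
    have := hM.layer_iterate q k (by omega)
    exact hM.morphism _ _ _ (by omega) (ih (by omega))

theorem layer_run {q q' : M.State} {v : List A} (h : M.run q v = some q') :
    M.layer q' = M.layer q := by
  induction v generalizing q with
  | nil => cases h; rfl
  | cons a v ih =>
    obtain ⟨r, hr, h⟩ := Option.bind_eq_some_iff.1 h
    exact (ih h).trans (hM.layer_next _ _ _ hr)

theorem run_parent {q q' : M.State} {v : List A} (hq : 2 ≤ M.layer q)
    (h : M.run q v = some q') : M.run (M.parent q) v = some (M.parent q') := by
  induction v generalizing q with
  | nil => cases h; rfl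
  | cons a v ih =>
    obtain ⟨r, hr, h⟩ := Option.bind_eq_some_iff.1 h
    refine Option.bind_eq_some_iff.2 ⟨_, hM.morphism _ _ _ hq hr, ih ?_ h⟩
    rwa [hM.layer_next _ _ _ hr]

theorem exists_leaf (p : M.State) :
    ∃ q : M.sem.State, M.layer p ≤ M.layer q.1 ∧ M.ancestor (M.layer p) q.1 = p := by
  induction h : d - M.layer p using Nat.strong_induction_on generalizing p with
  | _ n ih =>
    by_cases hp : M.IsLeaf p
    · exact ⟨⟨p, hp⟩, le_rfl, ancestor_layer p⟩
    · obtain ⟨r, hr, rfl⟩ := not_not.1 hp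
      have h1 := hM.layer_parent r hr
      have h2 := (hM.layer_mem r).2
      obtain ⟨q, hq, e⟩ := ih _ (by omega) r rfl
      refine ⟨q, by omega, ?_⟩
      rw [← parent_ancestor (by omega), h1, e]

theorem exists_step (q : M.sem.State) (a : A) : ∃ x q', M.sem.Step q a x q' := by
  have hq := (hM.layer_mem q.1).1
  obtain ⟨x, hx⟩ : ∃ x, M.IsPriority q.1 a x := by
    have fin : {y | y ∈ Set.Icc 1 (M.layer q.1) ∧
        (M.next (M.ancestor y q.1) a).isSome}.Finite :=
      (Set.finite_Icc 1 (M.layer q.1)).subset fun y hy => hy.1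
    exact BddAbove.exists_isGreatest_of_nonempty fin.bddAbove
      ⟨1, ⟨le_rfl, hq⟩, hM.complete _ _ (hM.layer_ancestor le_rfl hq)⟩
  obtain ⟨r, hr⟩ := Option.isSome_iff_exists.1 hx.1.2
  have hl := hM.layer_next _ _ _ hr
  rw [hM.layer_ancestor hx.1.1.1 hx.1.1.2] at hl
  obtain ⟨q', hq', e⟩ := hM.exists_leaf r
  rw [hl] at hq' e
  exact ⟨x, q', hx, hq', by rw [e, hr]⟩

theorem step_ancestor {q q' : M.sem.State} {a : A} {x y : ℕ} (h : M.sem.Step q a x q')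
    (hy : 1 ≤ y) (hyx : y ≤ x) :
    M.next (M.ancestor y q.1) a = some (M.ancestor y q'.1) := by
  obtain ⟨h1, h2, h3⟩ := h
  have := hM.next_ancestor h3 hy (by rwa [hM.layer_ancestor h1.1.1.1 h1.1.1.2])
  rwa [hM.ancestor_ancestor hy hyx h1.1.1.2, hM.ancestor_ancestor hy hyx h2] at this

end IsLayeredAutomaton

/-! ### The semantics game when the layers decide strongly safe words -/

/-- The layers decide the acceptance of strongly safe words in accordance with `L`. -/
def StronglySafeParity (M : LayeredData.{u, v} A) (L : Set (Stream' A)) : Prop :=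
  ∀ u p w, M.run M.start u = some (M.ancestor 1 p) → M.StronglySafe p w →
    (Stream'.appendStream' u w ∈ L ↔ Even (M.layer p))

variable {L : Set (Stream' A)}

theorem consistent_of_parity (hM : M.IsLayeredAutomaton d) (hL : M.StronglySafeParity L) :
    M.Consistent := by
  rintro ⟨p, p', w, e, ⟨h1, h2⟩, h3, h4⟩
  obtain ⟨u, hu⟩ := hM.reachable _ (hM.layer_ancestor le_rfl (hM.layer_mem p).1)
  have := (hL u p w hu h2).symm.trans (hL u p' w (e ▸ hu) h4)
  exact Nat.not_even_iff_odd.2 h3 (this.1 h1)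

/-- The least priority `x` seen infinitely often on a run is correct if its owner moves below a
state of layer `x + 1` from which the remaining word is safe whenever there is one. -/
theorem mem_iff_even_of_run (hM : M.IsLayeredAutomaton d) (hL : M.StronglySafeParity L)
    {w : Stream' A} {q : M.sem.State} (hq : M.IsInitialLeaf q) {ρ : ℕ → M.sem.State}
    {p : ℕ → ℕ} (hr : M.sem.IsRun w q ρ p) {x : ℕ}
    (good : ∀ i, p i = x → ∀ p', M.layer p' = x + 1 →
      M.parent p' = M.ancestor x (ρ (i + 1)).1 → M.Safe p' (w.drop (i + 1)) →
      x + 1 ≤ M.layer (ρ (i + 1)).1 ∧ M.Safe (M.ancestor (x + 1) (ρ (i + 1)).1) (w.drop (i + 1)))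
    (ev : ∀ᶠ i in atTop, x ≤ p i) (fr : ∃ᶠ i in atTop, p i = x) : w ∈ L ↔ Even x := by
  obtain ⟨N, hN⟩ := eventually_atTop.1 ev
  have step := hr.2
  have hx : 1 ≤ x := by
    obtain ⟨i, rfl⟩ := fr.exists
    exact (step i).1.1.1.1
  have lay : ∀ i ≥ N, x ≤ M.layer (ρ i).1 := fun i hi =>
    (hN i hi).trans (step i).1.1.1.2
  have run1 : ∀ n, M.run M.start (w.take n) = some (M.ancestor 1 (ρ n).1) := fun n => by
    induction n with
    | zero => rw [hr.1, show M.ancestor 1 q.1 = M.start from hq]; rfl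
    | succ n ih =>
      rw [run_take_succ ih]
      exact hM.step_ancestor (step n) le_rfl (step n).1.1.1.1
  have runx : ∀ k, M.run (M.ancestor x (ρ N).1) ((w.drop N).take k) =
      some (M.ancestor x (ρ (N + k)).1) := fun k => by
    induction k with
    | zero => rfl
    | succ k ih =>
      rw [run_take_succ ih, Stream'.get_drop]
      exact hM.step_ancestor (step _) hx (hN _ (by omega))
  have hl := hM.layer_ancestor hx (lay N le_rfl)
  by_cases strong : M.StronglySafe (M.ancestor x (ρ N).1) (w.drop N)
  · have := hL (w.take N) _ _
      (by rw [hM.ancestor_ancestor le_rfl hx (lay N le_rfl)]; exact run1 N) strong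
    rwa [hl, Stream'.append_take_drop] at this
  -- Otherwise a suffix is safe from some state on layer `x + 1`. At the next occurrence of `x`,
  -- `good` puts the run below such a state, and from then on all priorities exceed `x`.
  exfalso
  have safe : M.Safe (M.ancestor x (ρ N).1) (w.drop N) := fun k => by simp [runx]
  simp only [StronglySafe, safe, true_and, not_forall, not_not, hl] at strong
  obtain ⟨n, p', hp', e, safe'⟩ := strong
  rw [runx, Option.some.injEq] at e
  rw [Stream'.drop_drop] at safe'
  obtain ⟨i, hi, hni⟩ := (fr.and_eventually (eventually_ge_atTop (N + n))).exists
  obtain ⟨k, rfl⟩ := Nat.exists_eq_add_of_le hni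
  obtain ⟨p'', hrun⟩ := Option.isSome_iff_exists.1 (safe' (k + 1))
  have par : M.parent p'' = M.ancestor x (ρ (N + n + k + 1)).1 := by
    have h1 := hM.run_parent (by omega) hrun
    have h2 := runx (n + (k + 1))
    rw [Stream'.take_add, run_append, runx, Option.bind_some, Stream'.drop_drop, e, h1,
      Option.some.injEq] at h2
    rwa [show N + n + k + 1 = N + (n + (k + 1)) by omega]
  have safe'' := safe'.drop hrun
  rw [Stream'.drop_drop] at safe''
  obtain ⟨hl0, hs0⟩ := good _ hi p'' ((hM.layer_run hrun).trans hp') par safe''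
  set m := N + n + k + 1 with hm
  have prio : ∀ j, x + 1 ≤ M.layer (ρ (m + j)).1 →
      M.run (M.ancestor (x + 1) (ρ m).1) ((w.drop m).take j) =
        some (M.ancestor (x + 1) (ρ (m + j)).1) → x + 1 ≤ p (m + j) := fun j h1 h2 => by
    have := hs0 (j + 1)
    rw [run_take_succ h2, Stream'.get_drop] at this
    exact (step (m + j)).1.2 ⟨⟨by omega, h1⟩, this⟩
  have inv : ∀ j, x + 1 ≤ M.layer (ρ (m + j)).1 ∧
      M.run (M.ancestor (x + 1) (ρ m).1) ((w.drop m).take j) =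
        some (M.ancestor (x + 1) (ρ (m + j)).1) := fun j => by
    induction j with
    | zero => exact ⟨hl0, rfl⟩
    | succ j ih =>
      have := prio j ih.1 ih.2
      refine ⟨this.trans (step _).2.1, ?_⟩
      rw [run_take_succ ih.2, Stream'.get_drop]
      exact hM.step_ancestor (step _) (by omega) this
  obtain ⟨i, hi', hmi⟩ := (fr.and_eventually (eventually_ge_atTop m)).exists
  obtain ⟨j, rfl⟩ := Nat.exists_eq_add_of_le hmi
  have := prio j (inv j).1 (inv j).2
  omega

/-- A transition at time `i` from `q` to `q'` with some priority `x` such that the remaining word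
is safe from the ancestor of `q'` on layer `x + 1`. -/
def SafeMove (w : Stream' A) (i : ℕ) (q q' : M.sem.State) : Prop :=
  ∃ x, M.sem.Step q (w.get i) x q' ∧ x + 1 ≤ M.layer q'.1 ∧
    M.Safe (M.ancestor (x + 1) q'.1) (w.drop (i + 1))

/-- One rule serves both players. It may depend on the time, since the whole word is known. -/
theorem exists_move (hM : M.IsLayeredAutomaton d) (w : Stream' A) (i : ℕ) (q : M.sem.State) :
    ∃ q' : M.sem.State, (∃ x, M.sem.Step q (w.get i) x q') ∧
      ∀ r : M.sem.State, SafeMove w i q r → SafeMove w i q q' := by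
  by_cases h : ∃ r : M.sem.State, SafeMove w i q r
  · obtain ⟨r, hr⟩ := h
    exact ⟨r, ⟨hr.choose, hr.choose_spec.1⟩, fun _ _ => hr⟩
  · obtain ⟨x, q', hx⟩ := hM.exists_step q (w.get i)
    exact ⟨q', ⟨x, hx⟩, fun r hr => (h ⟨r, hr⟩).elim⟩

/-- Any leaf below `p'` would be a safe move, so the chosen move is safe too; uniqueness of the
priority fixes the layer concerned. -/
theorem good_of_move (hM : M.IsLayeredAutomaton d) {w : Stream' A} {i x : ℕ}
    {q q' : M.sem.State} (hs : M.sem.Step q (w.get i) x q')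
    (hm : ∀ r : M.sem.State, SafeMove w i q r → SafeMove w i q q') (p' : M.State)
    (hl : M.layer p' = x + 1) (hp : M.parent p' = M.ancestor x q'.1)
    (safe : M.Safe p' (w.drop (i + 1))) :
    x + 1 ≤ M.layer q'.1 ∧ M.Safe (M.ancestor (x + 1) q'.1) (w.drop (i + 1)) := by
  obtain ⟨r, hr, e⟩ := hM.exists_leaf p'
  rw [hl] at hr e
  obtain ⟨y, hy, h1, h2⟩ := hm r ⟨x, ⟨hs.1, by omega, by
    rw [← parent_ancestor hr, e, hp]
    exact hs.2.2⟩, hr, e ▸ safe⟩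
  obtain rfl := isPriority_unique hs.1 hy.1
  exact ⟨h1, h2⟩

theorem history_succ {B : AltAutomaton.{u, v} A} (ρ : ℕ → B.State) (i : ℕ) :
    B.history ρ (i + 1) = B.history ρ i ++ [ρ (i + 1)] := by
  simp [AltAutomaton.history, List.range_succ]

theorem getLastD_history {B : AltAutomaton.{u, v} A} (ρ : ℕ → B.State) (i : ℕ) (q : B.State) :
    (B.history ρ i).getLastD q = ρ i := by
  simp [AltAutomaton.history, List.range_succ, List.getLastD_eq_getLast?]

theorem mem_language (hM : M.IsLayeredAutomaton d) (hL : M.StronglySafeParity L)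
    {w : Stream' A} {q : M.sem.State} (hq : M.IsInitialLeaf q) (hw : w ∈ L) :
    w ∈ M.sem.language q := by
  choose move step safe using exists_move hM w
  -- The history at time `i` has `i + 1` entries, so its length minus one recovers the time.
  have hσ : ∀ ρ i, move ((M.sem.history ρ i).length - 1) ((M.sem.history ρ i).getLastD q) =
      move i (ρ i) := fun ρ i => by
    rw [getLastD_history]
    simp [AltAutomaton.history]
  refine ⟨fun h => move (h.length - 1) (h.getLastD q), ?_, ?_⟩
  · intro ρ i _ _ x q' _ hs
    obtain ⟨y, hy⟩ := step i (ρ i)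
    obtain rfl := isPriority_unique hs.1 hy.1
    rwa [← hσ] at hy
  · intro ρ p hr hodd
    obtain ⟨x, ev, fr⟩ := exists_liminf (p := p) (D := d) fun i =>
      (hr.2 i).1.1.1.2.trans (hM.layer_mem _).2
    rw [parity_iff_even ev fr]
    by_contra hx
    refine hx ((mem_iff_even_of_run hM hL hq hr ?_ ev fr).1 hw)
    rintro i rfl
    have := (hodd i (Nat.not_even_iff_odd.1 hx)).trans (hσ ρ i)
    exact good_of_move hM (hr.2 i) (this ▸ safe i (ρ i))

/-- Let Adam's choices follow the rule against a winning strategy of Eve. The resulting run has an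
even least recurring priority, owned by Adam, so the word lies in `L`. -/
theorem mem_of_mem_language (hM : M.IsLayeredAutomaton d) (hL : M.StronglySafeParity L)
    {w : Stream' A} {q : M.sem.State} (hq : M.IsInitialLeaf q) (hw : w ∈ M.sem.language q) :
    w ∈ L := by
  classical
  obtain ⟨σ, legal, win⟩ := hw
  choose move step safe using exists_move hM w
  -- The next state must be computed from the history, as `σ` reads all of it; the run is then the
  -- last entry of the histories `H`.
  let nxt : ℕ → List M.sem.State → M.sem.State := fun n h =>
    if ∃ x, Odd x ∧ M.IsPriority (h.getLastD q).1 (w.get n) x then σ h else move n (h.getLastD q)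
  let H : ℕ → List M.sem.State := fun n => n.rec [q] fun n h => h ++ [nxt n h]
  let ρ : ℕ → M.sem.State := fun n => (H n).getLastD q
  have hρ0 : ρ 0 = q := rfl
  have hρ : ∀ n, ρ (n + 1) = nxt n (H n) := fun n => by
    simp only [ρ, H, List.getLastD_eq_getLast?, List.getLast?_append]
    rfl
  have hH : ∀ n, H n = M.sem.history ρ n := fun n => by
    induction n with
    | zero => rfl
    | succ n ih => rw [history_succ, ← ih, hρ]
  have hodd : ∀ n x, Odd x → M.IsPriority (ρ n).1 (w.get n) x →
      ρ (n + 1) = σ (M.sem.history ρ n) := fun n x h1 h2 => by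
    rw [hρ, ← hH]
    exact if_pos ⟨x, h1, h2⟩
  have heven : ∀ n x, Even x → M.IsPriority (ρ n).1 (w.get n) x → ρ (n + 1) = move n (ρ n) :=
    fun n x h1 h2 => by
      rw [hρ]
      refine if_neg ?_
      rintro ⟨y, hy, hy'⟩
      obtain rfl := isPriority_unique h2 hy'
      exact Nat.not_even_iff_odd.2 hy h1
  have hstep : ∀ n, ∃ x, M.sem.Step (ρ n) (w.get n) x (ρ (n + 1)) := fun n => by
    induction n using Nat.strong_induction_on with
    | _ n ih =>
      obtain ⟨x, hx⟩ := step n (ρ n)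
      rcases Nat.even_or_odd x with h | h
      · exact ⟨x, by rwa [heven n x h hx.1]⟩
      · refine ⟨x, ?_⟩
        rw [hodd n x h hx.1]
        exact legal ρ n hρ0 ih x _ h hx
  choose p hp using hstep
  have hr : M.sem.IsRun w q ρ p := ⟨hρ0, hp⟩
  obtain ⟨x, ev, fr⟩ := exists_liminf (p := p) (D := d) fun i =>
    (hr.2 i).1.1.1.2.trans (hM.layer_mem _).2
  have hx := (parity_iff_even ev fr).1 (win ρ p hr fun i hi => hodd i _ hi (hp i).1)
  refine (mem_iff_even_of_run hM hL hq hr ?_ ev fr).2 hx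
  rintro i rfl
  exact good_of_move hM (hp i) (heven i _ hx (hp i).1 ▸ safe i (ρ i))

theorem recognises_of_parity (hM : M.IsLayeredAutomaton d) (hL : M.StronglySafeParity L) :
    M.Recognises L := by
  refine ⟨?_, fun q hq => Set.Subset.antisymm (fun w hw => mem_of_mem_language hM hL hq hw)
    fun w hw => mem_language hM hL hq hw⟩
  obtain ⟨q, -, e⟩ := hM.exists_leaf M.start
  rw [hM.layer_start] at e
  exact ⟨q, e⟩

end LayeredData

/-! ### The automaton of the congruence -/

section automaton

open WordTuple

variable {A : Type u} {L : Set (Stream' A)}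

theorem WordTuple.word_merge (t : WordTuple A) : t.merge.word = t.word := by
  cases t <;> simp [merge, word, word_concat]

theorem WordTuple.merge_iterate {t : WordTuple A} {k : ℕ} (h : t.length = k + 1) :
    WordTuple.merge^[k] t = single t.word := by
  induction k generalizing t with
  | zero =>
    cases t with
    | single u => rfl
    | snoc t z => exact absurd h (by have := t.length_pos; simp only [length]; omega)
  | succ k ih =>
    cases t with
    | single u => simp [length] at h
    | snoc t z =>
      have hl : (snoc t z).merge.length = k + 1 := by
        simpa only [merge, length_concat, length, Nat.add_right_cancel_iff] using h
      rw [Function.iterate_succ_apply, ih hl, word_merge]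

namespace TupleClass

theorem concat_nil (c : TupleClass L) : c.concat [] = c := by
  induction c using Quotient.inductionOn with
  | h t => exact congrArg _ t.concat_nil

theorem concat_concat (c : TupleClass L) (v w : List A) :
    (c.concat v).concat w = c.concat (v ++ w) := by
  induction c using Quotient.inductionOn with
  | h t => exact congrArg (Quotient.mk _) (WordTuple.concat_concat t v w)

theorem length_concat (c : TupleClass L) (v : List A) : (c.concat v).length = c.length := by
  induction c using Quotient.inductionOn with
  | h t => exact WordTuple.length_concat t v

theorem IsBot.concat {c : TupleClass L} (h : c.IsBot) (v : List A) : (c.concat v).IsBot := by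
  induction c using Quotient.inductionOn with
  | h t => exact bot_concat (t := t) h v

theorem IsPointed.not_isBot {c : TupleClass L} (h : c.IsPointed) : ¬ c.IsBot := by
  obtain ⟨t, ht, rfl⟩ := h
  exact not_bot_of_pointed ht

end TupleClass

theorem next_eq_some {c c' : (congruenceAutomaton L).State} {a : A} :
    (congruenceAutomaton L).next c a = some c' ↔
      ¬ (c.1.concat [a]).IsBot ∧ c'.1 = c.1.concat [a] := by
  simp only [congruenceAutomaton]
  split_ifs with h
  · simp [h]
  · exact ⟨fun e => ⟨h, (congrArg Subtype.val (Option.some.inj e)).symm⟩,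
      fun e => congrArg some (Subtype.ext e.2.symm)⟩

theorem run_eq_some {c c' : (congruenceAutomaton L).State} {v : List A} :
    (congruenceAutomaton L).run c v = some c' ↔
      ¬ (c.1.concat v).IsBot ∧ c'.1 = c.1.concat v := by
  induction v generalizing c with
  | nil =>
    rw [TupleClass.concat_nil]
    rw [LayeredData.run, Option.some.injEq]
    exact ⟨fun e => ⟨c.2.not_isBot, (congrArg Subtype.val e).symm⟩,
      fun e => Subtype.ext e.2.symm⟩
  | cons a v ih =>
    simp only [LayeredData.run, Option.bind_eq_some_iff, next_eq_some, ih]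
    have e : (c.1.concat [a]).concat v = c.1.concat (a :: v) := TupleClass.concat_concat _ _ _
    constructor
    · rintro ⟨r, ⟨h1, h2⟩, h3, h4⟩
      rw [h2, e] at h3 h4
      exact ⟨h3, h4⟩
    · rintro ⟨h1, h2⟩
      have h : ¬ (c.1.concat [a]).IsBot := fun h => h1 (e ▸ h.concat v)
      exact ⟨⟨_, TupleClass.isPointed_concat c.2 h⟩, ⟨h, rfl⟩, by rwa [e], by rwa [e]⟩

theorem run_isSome {c : (congruenceAutomaton L).State} {v : List A} :
    ((congruenceAutomaton L).run c v).isSome ↔ ¬ (c.1.concat v).IsBot := by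
  rw [Option.isSome_iff_exists]
  simp only [run_eq_some, exists_and_left, and_iff_left_iff_imp]
  exact fun h => ⟨⟨_, TupleClass.isPointed_concat c.2 h⟩, rfl⟩

theorem ancestor_one (c : (congruenceAutomaton L).State) {t : WordTuple A} (h : c.1 = ⟦t⟧) :
    ((congruenceAutomaton L).ancestor 1 c).1 = ⟦single t.word⟧ := by
  have iter : ∀ k, ((congruenceAutomaton L).parent^[k] c).1 = ⟦WordTuple.merge^[k] t⟧ :=
    fun k => by
      induction k with
      | zero => exact h
      | succ k ih =>
        rw [Function.iterate_succ_apply', Function.iterate_succ_apply']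
        change TupleClass.merge _ = _
        rw [ih]
        rfl
  have hl : (congruenceAutomaton L).layer c = t.length := by
    change c.1.length = _
    rw [h]
    rfl
  have := t.length_pos
  rw [LayeredData.ancestor, iter, hl, merge_iterate (by omega)]

theorem isLayeredAutomaton_congruenceAutomaton {d : ℕ}
    (fin : ∀ n, {c : TupleClass L | c.length = n}.Finite)
    (hd : IsGreatest {x | ∃ t : WordTuple A, t.length = x ∧ ¬ Bot L t} d) :
    (congruenceAutomaton L).IsLayeredAutomaton d where
  finite := by
    refine Set.Finite.to_subtype (((Set.finite_Iic d).biUnion fun n _ => fin n).subset ?_)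
    rintro _ ⟨t, ht, rfl⟩
    exact Set.mem_biUnion (hd.2 ⟨t, rfl, not_bot_of_pointed ht⟩) rfl
  layer_mem := by
    rintro ⟨_, t, ht, rfl⟩
    exact ⟨t.length_pos, hd.2 ⟨t, rfl, not_bot_of_pointed ht⟩⟩
  layer_next c a c' h := by
    change c'.1.length = c.1.length
    rw [(next_eq_some.1 h).2, TupleClass.length_concat]
  layer_parent := by
    rintro ⟨_, t | ⟨t, z⟩, ht, rfl⟩ h
    · exact absurd h (by change ¬ 2 ≤ 1; omega)
    · exact congrArg (· + 1) (length_concat t z)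
  morphism := by
    rintro ⟨_, t | ⟨t, z⟩, ht, rfl⟩ a c' h hn
    · exact absurd h (by change ¬ 2 ≤ 1; omega)
    · obtain ⟨h1, h2⟩ := next_eq_some.1 hn
      have e : (t.concat z).concat [a] = t.concat (z ++ [a]) := concat_concat t z [a]
      refine next_eq_some.2 ⟨fun hb => h1 ?_, ?_⟩
      · change Bot L ((t.concat z).concat [a]) at hb
        rw [e] at hb
        exact (bot_snoc _ _ _).2 (.inl hb)
      · change c'.1.merge = _
        rw [h2]
        exact congrArg (Quotient.mk _) e.symm
  complete := by
    rintro ⟨_, t | ⟨t, z⟩, ht, rfl⟩ a h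
    · refine Option.isSome_iff_exists.2 ⟨⟨⟦single (t ++ [a])⟧, _, pointed_single L _, rfl⟩, ?_⟩
      exact next_eq_some.2 ⟨bot_single L _, rfl⟩
    · have := t.length_pos
      change t.length + 1 = 1 at h
      omega
  layer_start := rfl
  reachable := by
    rintro ⟨_, t | ⟨t, z⟩, ht, rfl⟩ h
    · exact ⟨t, run_eq_some.2 ⟨bot_single L _, rfl⟩⟩
    · have := t.length_pos
      change t.length + 1 = 1 at h
      omega

/-- The ancestor on layer one is the residual class of the concatenated tuple, so `u` may be
replaced by that concatenation, and `mem_iff_even_length` applies. -/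
theorem stronglySafeParity_congruenceAutomaton {d : ℕ} (B : DPA A d) :
    (congruenceAutomaton B.language).StronglySafeParity B.language := by
  rintro u ⟨_, t, ht, rfl⟩ w hu ⟨safe, strong⟩
  have hres : Equiv B.language (single t.word) (single u) := Quotient.exact
    ((ancestor_one ⟨⟦t⟧, t, ht, rfl⟩ rfl).symm.trans (run_eq_some.1 hu).2)
  rw [← (equiv_single _ _ _).1 hres]
  refine mem_iff_even_length B ht (fun n => run_isSome.1 (safe n)) ?_
  intro n s z hp hl e hs
  refine strong n ⟨⟦snoc s z⟧, _, hp, rfl⟩ (congrArg (· + 1) hl) ?_ fun m => run_isSome.2 (hs m)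
  exact run_eq_some.2 ⟨run_isSome.1 (safe n), Quotient.sound e⟩

end automaton

end LayeredAut

theorem mainTheorem4 {A : Type*} (L : Set (Stream' A)) (hL : LayeredAut.OmegaRegular L) :
    ∃ d : ℕ,
      IsGreatest {x | ∃ t : LayeredAut.WordTuple A, t.length = x ∧ ¬ LayeredAut.Bot L t} d ∧
      (LayeredAut.congruenceAutomaton L).IsLayeredAutomaton d ∧
      (LayeredAut.congruenceAutomaton L).Consistent ∧
      (LayeredAut.congruenceAutomaton L).Recognises L := by
  obtain ⟨D, B, rfl⟩ := hL
  obtain ⟨d, hd⟩ := BddAbove.exists_isGreatest_of_nonempty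
    (S := {x | ∃ t : LayeredAut.WordTuple A, t.length = x ∧ ¬ LayeredAut.Bot B.language t})
    ⟨D + 1, by
      rintro _ ⟨t, rfl, ht⟩
      exact LayeredAut.length_le B t ht⟩
    ⟨1, .single [], rfl, LayeredAut.bot_single _ _⟩
  have hM := LayeredAut.isLayeredAutomaton_congruenceAutomaton (LayeredAut.finite_classes B) hd
  have hP := LayeredAut.stronglySafeParity_congruenceAutomaton B
  exact ⟨d, hd, hM, LayeredAut.LayeredData.consistent_of_parity hM hP,
    LayeredAut.LayeredData.recognises_of_parity hM hP⟩
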